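/- A $C$-algebra is a pair $\mathcal A=(A,\mathcal R)$, where $A$ is an associative $\mathbb C$-algebra with unit $e$ and a semilinear involutive anti-automorphism $*$, and $\mathcal R$ is a finite linear basis of $A$ such that, with $rs=\sum_{t\in\mathcal R}c_{r,s}^t\,t$: (C1) $e\in\mathcal R$ and $\mathcal R^*=\mathcal R$; (C2) all $c_{r,s}^t$ are real; (C3) $c_{r,s}^e=d_r\delta_{r^*,s}$ with $d_r>0$; (C4) the linear functional $r\mapsto d_r$ is a one-dimensional $*$-representation of $A$. Put $\mathcal R^\#=\mathcal R\setminus\{e\}$ and $n=\sum_{r\in\mathcal R}d_r$. The algebra $\mathcal A$ is a *table algebra* if all $c_{r,s}^t\ge 0$; it is *homogeneous* if $d_r$ is the same for all $r\in\mathcal R^\#$; it is *amorphic* if for every partition $\pi$ of $\mathcal R$ with $\{e\}\in\pi$ the span of the sums $\sum_{r\in C}r$, $C\in\pi$, together with these sums as basis, is a $C$-algebra. *Isomorphisms* of $C$-algebras are $*$-algebra isomorphisms that map basis onto basis. The *dual* $\widehat{\mathcal A}$ of a commutative $C$-algebra $\mathcal A$ is the algebra of all functions $\mathcal R\to\mathbb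 C$, with pointwise multiplication and pointwise complex conjugation as involution, based by the functions $r\mapsto Q_{p,r}$, where $p=\frac1n\sum_{r\in\mathcal R}Q_{p,r}\,r$ runs over the primitive idempotents of $A$. (Every amorphic $C$-algebra is commutative.) For $\varepsilon\in\{-1,+1\}$, an integer $\nu\ge4$ and a real $d>0$, the class $\mathcal A_\varepsilon(\nu,d)$ consists of the algebras with a basis $\mathcal R\ni e$ of size $\nu$, all of whose elements are fixed by $*$, where $e$ is the unit, $c_{r,s}^e=d_r\delta_{r,s}$ with $d_e=1$ and $d_r=d$ for $r\in\mathcal R^\#$, and, with $n=1+(\nu-1)d$ and $d'=n-1-d$, for $r,s,t\in\mathcal R^\#$ $$c_{r,s}^t=\begin{cases}\dfrac{d^2}{(\sqrt n+\varepsilon)^2},&|\{r,s,t\}|=3,\\[6pt]\dfrac d2\Big(1+\dfrac{d-d'}{(\sqrt n+\varepsilon)^2}\Big),&|\{r,s,t\}|=2,\\[6pt]-\dfrac{d'}2\Big(1+\dfrac{d-d'}{(\sqrt n+\varepsilon)^2}\Big)+d-1,&r=s=t.\end{cases}$$ **Theorem.** Let $\mathcal A$ be a homogeneous amorphic table algebra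 of dimension $\ne 3$ (in particular, any such algebra of dimension at least $4$). Then the dual $\widehat{\mathcal A}$ is also a homogeneous amorphic table algebra. Moreover, for all $\varepsilon,\nu,d$, if $\mathcal A\in\mathcal A_\varepsilon(\nu,d)$ then $\widehat{\mathcal A}\in\mathcal A_\varepsilon(\nu,d)$. In particular, $\mathcal A$ and $\widehat{\mathcal A}$ are isomorphic. -/

import Mathlib

/-! Throughout, `A` is an associative unital algebra over `ℂ` with a semilinear involutive
anti-automorphism `star`, a finite linear basis of `A` is given as a family `b` indexed by a
finite type, and `e` is the index of the basis element that is to be the unit of `A`. -/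

namespace CAlg

/-- The structure constant `c_{r,s}^t`: the coefficient of `b t` in `b r * b s`. -/
noncomputable def structConst {ι A : Type*} [Ring A] [Algebra ℂ A]
    (b : Module.Basis ι ℂ A) (r s t : ι) : ℂ :=
  b.repr (b r * b s) t

/-- The degree `d_r` of the basis element `b r`: the coefficient of the unit in
`b r * star (b r)` (a real number by condition (C2) below). -/
noncomputable def degree {ι A : Type*} [Ring A] [Algebra ℂ A] [StarRing A]
    (b : Module.Basis ι ℂ A) (e r : ι) : ℝ :=
  (b.repr (b r * star (b r)) e).re

/-- The degree `n = ∑ d_r` of the algebra. -/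
noncomputable def totalDegree {ι A : Type*} [Fintype ι] [Ring A] [Algebra ℂ A] [StarRing A]
    (b : Module.Basis ι ℂ A) (e : ι) : ℝ :=
  ∑ r, degree b e r

/-- `(A, {b r})` is a `C`-algebra. -/
structure IsCAlgebra {ι A : Type*} [Fintype ι] [Ring A] [Algebra ℂ A] [StarRing A]
    [StarModule ℂ A] (b : Module.Basis ι ℂ A) (e : ι) : Prop where
  /-- (C1), first half: the unit belongs to the basis. -/
  basis_one : b e = 1
  /-- (C1), second half: the basis is closed under the involution. -/
  basis_star : ∀ r, ∃ s, star (b r) = b s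
  /-- (C2): the structure constants are real. -/
  const_real : ∀ r s t, (structConst b r s t).im = 0
  /-- (C3), positivity. -/
  degree_pos : ∀ r, 0 < degree b e r
  /-- (C3): `c_{r,s}^e` is `d_r` if `s = r*`, and zero otherwise. -/
  const_self : ∀ r, ∀ s, star (b r) = b s → structConst b r s e = (degree b e r : ℂ)
  const_ne : ∀ r, ∀ s, star (b r) ≠ b s → structConst b r s e = 0
  /-- (C4): the linear functional `b r ↦ d_r` is a one-dimensional `*`-representation. -/
  degree_rep : ∃ φ : A →⋆ₐ[ℂ] ℂ, ∀ r, φ (b r) = (degree b e r : ℂ)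

/-- A table algebra is a `C`-algebra with nonnegative structure constants. -/
def IsTableAlgebra {ι A : Type*} [Fintype ι] [Ring A] [Algebra ℂ A] [StarRing A]
    [StarModule ℂ A] (b : Module.Basis ι ℂ A) (e : ι) : Prop :=
  IsCAlgebra b e ∧ ∀ r s t, 0 ≤ (structConst b r s t).re

/-- The degree `d_r` does not depend on the basis element `b r` other than the unit. -/
def IsHomogeneous {ι A : Type*} [Ring A] [Algebra ℂ A] [StarRing A]
    (b : Module.Basis ι ℂ A) (e : ι) : Prop :=
  ∀ r s, r ≠ e → s ≠ e → degree b e r = degree b e s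

/-- For a partition `π` of the basis that has the class `{e}`, the `π`-fusion, that is the linear
span of the sums of the basis elements over the classes of `π`, together with these sums,
is a `C`-algebra (with the operations inherited from `A`). -/
def FusionIsCAlgebra {ι A : Type*} [Fintype ι] [DecidableEq ι] [Ring A] [Algebra ℂ A]
    [StarRing A] [StarModule ℂ A] (b : Module.Basis ι ℂ A) (e : ι)
    (π : Finpartition (Finset.univ : Finset ι)) (he : {e} ∈ π.parts) : Prop :=
  ∃ (B : StarSubalgebra ℂ A) (b' : Module.Basis π.parts ℂ B),
    (∀ C : π.parts, (b' C : A) = ∑ r ∈ C.1, b r) ∧ IsCAlgebra b' ⟨{e}, he⟩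

/-- A `C`-algebra is amorphic if all its fusions are `C`-algebras. -/
def IsAmorphic {ι A : Type*} [Fintype ι] [DecidableEq ι] [Ring A] [Algebra ℂ A]
    [StarRing A] [StarModule ℂ A] (b : Module.Basis ι ℂ A) (e : ι) : Prop :=
  IsCAlgebra b e ∧
    ∀ (π : Finpartition (Finset.univ : Finset ι)) (he : {e} ∈ π.parts), FusionIsCAlgebra b e π he

/-- Isomorphism of based algebras: an isomorphism of `*`-algebras that maps basis onto basis. -/
def Isomorphic {ι A κ B : Type*} [Ring A] [Algebra ℂ A] [StarRing A]
    [Ring B] [Algebra ℂ B] [StarRing B]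
    (b : Module.Basis ι ℂ A) (b' : Module.Basis κ ℂ B) : Prop :=
  ∃ φ : A ≃⋆ₐ[ℂ] B, φ '' Set.range b = Set.range b'

/-- The structure constants `c_{r,s}^t` of the algebra `A_ε(R, D)`, for `d : R → ℝ` with
`d e = 1`. If two of `r, s, t ≠ e` coincide, the value follows from the case `r = s ≠ t` by
`d_t c_{r,s}^t = d_r c_{s,t}^r = d_s c_{t,r}^s`. -/
noncomputable def amorphicConst {ι : Type*} [Fintype ι] [DecidableEq ι]
    (ε : ℤ) (e : ι) (d : ι → ℝ) (r s t : ι) : ℝ :=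
  let n : ℝ := ∑ i, d i
  let d' : ι → ℝ := fun u => n - 1 - d u
  let Q : ℝ := (√n + ε) ^ 2
  let c₂ : ι → ℝ := fun u => d u / 2 * (1 + (d u - d' u) / Q)
  if t = e then (if r = s then d r else 0)
  else if r = e then (if s = t then 1 else 0)
  else if s = e then (if r = t then 1 else 0)
  else if r = s then
    (if s = t then -(d' r) / 2 * (1 + (d r - d' r) / Q) + d r - 1 else c₂ r)
  else if r = t then d s / d r * c₂ r
  else if s = t then d r / d s * c₂ s
  else d r * d s / Q

/-- The class `A_ε(ν, d)`: the algebras `A_ε(R, D)` with `ν = |R| ≥ 4` and `D = {1, d, …, d}`. -/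
structure InClass {ι A : Type*} [Fintype ι] [DecidableEq ι] [Ring A] [Algebra ℂ A]
    [StarRing A] (b : Module.Basis ι ℂ A) (e : ι) (ε : ℤ) (ν : ℕ) (d : ℝ) : Prop where
  sign : ε = 1 ∨ ε = -1
  four_le : 4 ≤ ν
  card_eq : Fintype.card ι = ν
  pos : 0 < d
  star_basis : ∀ r, star (b r) = b r
  const_eq : ∀ r s t,
    structConst b r s t = (amorphicConst ε e (fun i => if i = e then 1 else d) r s t : ℂ)

/-- A primitive idempotent: a nonzero idempotent that is not the sum of two nonzero orthogonal
idempotents. -/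
def IsPrimitiveIdempotent {A : Type*} [Ring A] (p : A) : Prop :=
  IsIdempotentElem p ∧ p ≠ 0 ∧
    ∀ x y : A, IsIdempotentElem x → IsIdempotentElem y → x * y = 0 → y * x = 0 →
      p = x + y → x = 0 ∨ y = 0

/-- The type of primitive idempotents of `A`, which indexes the basis of the dual algebra. -/
def PrimIdem (A : Type*) [Ring A] : Type _ := {p : A // IsPrimitiveIdempotent p}

noncomputable instance (A : Type*) [Ring A] : DecidableEq (PrimIdem A) := Classical.decEq _

/-- The basis element of the dual of a commutative `C`-algebra that belongs to the primitive
idempotent `p = (1 / n) ∑ Q_{p,r} b r`: the function `r ↦ Q_{p,r}` on the basis, where `Q` is the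
second eigenmatrix. The dual is the algebra of functions `ι → ℂ` with pointwise multiplication
and pointwise complex conjugation as involution, based by these functions. -/
noncomputable def dualElem {ι A : Type*} [Fintype ι] [Ring A] [Algebra ℂ A] [StarRing A]
    (b : Module.Basis ι ℂ A) (e : ι) (p : PrimIdem A) : ι → ℂ :=
  fun r => (totalDegree b e : ℂ) * b.repr p.1 r

end CAlg

namespace CAlg

/-! ### Invariance of every notion under based `*`-isomorphisms. -/

section Transport

variable {ι κ A B : Type*} [Ring A] [Algebra ℂ A] [StarRing A] [Ring B] [Algebra ℂ B] [StarRing B]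
  {b : Module.Basis ι ℂ A} {b' : Module.Basis κ ℂ B}

/-! The algebra is self-dual because its character table `P` satisfies `P² = n I`. Write `N` for the
rank. Amorphicity makes the coefficients of a product of basis elements constant away from the
elements involved. Together with homogeneity, rank `≠ 3` and associativity, this leaves one real
parameter `y` that fixes the multiplication table (`IsAmorphic.exists_hasParameter`), with `n = w²`
for `w = 1 + (N - 1) y`.

The characters can then be indexed by the basis itself: besides the degree, there is one character
for each `i ≠ e`, with value `y - w` at `b i` and `y` at the other nonunit elements. For this
indexing `P² = n I` (`sum_eigenmatrix_mul`), so `(1/n) ∑ r, P r i • b r` is the primitive idempotent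
of the character `i`. Its dual basis element is the function `r ↦ P r i`, which is also the image of
`b i` under the isomorphism `A ≃ ℂ^ι` given by the characters (`HasParameter.exists_starAlgEquiv`).

Hence that isomorphism carries the basis of `A` onto the dual basis, and the table algebra property,
homogeneity, amorphicity and membership in each class follow by transport. -/

theorem repr_map_apply (φ : A ≃⋆ₐ[ℂ] B) (σ : ι ≃ κ) (h : ∀ r, b' (σ r) = φ (b r))
    (a : A) (r : ι) : b'.repr (φ a) (σ r) = b.repr a r := by
  have hb : b' = (b.map φ.toAlgEquiv.toLinearEquiv).reindex σ := by
    refine Module.Basis.eq_of_apply_eq fun k => ?_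
    obtain ⟨r, rfl⟩ := σ.surjective k
    simp [h]
  have hs : φ.toAlgEquiv.symm (φ a) = a := φ.toAlgEquiv.symm_apply_apply a
  rw [hb]
  simp [hs]

theorem structConst_map (φ : A ≃⋆ₐ[ℂ] B) (σ : ι ≃ κ) (h : ∀ r, b' (σ r) = φ (b r))
    (r s t : ι) : structConst b' (σ r) (σ s) (σ t) = structConst b r s t := by
  rw [structConst, structConst, h, h, ← map_mul, repr_map_apply φ σ h]

theorem degree_map (φ : A ≃⋆ₐ[ℂ] B) (σ : ι ≃ κ) (h : ∀ r, b' (σ r) = φ (b r))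
    (e r : ι) : degree b' (σ e) (σ r) = degree b e r := by
  rw [degree, degree, h, ← map_star, ← map_mul, repr_map_apply φ σ h]

theorem star_basis_map_iff (φ : A ≃⋆ₐ[ℂ] B) (σ : ι ≃ κ) (h : ∀ r, b' (σ r) = φ (b r))
    (r s : ι) : star (b' (σ r)) = b' (σ s) ↔ star (b r) = b s := by
  rw [h, h, ← map_star]
  exact φ.toAlgEquiv.injective.eq_iff

theorem IsCAlgebra.map [Fintype ι] [Fintype κ] [StarModule ℂ A] [StarModule ℂ B]
    (φ : A ≃⋆ₐ[ℂ] B) (σ : ι ≃ κ) (h : ∀ r, b' (σ r) = φ (b r)) {e : ι} (hb : IsCAlgebra b e) :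
    IsCAlgebra b' (σ e) where
  basis_one := by rw [h, hb.basis_one]; exact map_one φ.toAlgEquiv
  basis_star := by
    refine σ.surjective.forall.2 fun r => ?_
    obtain ⟨s, hs⟩ := hb.basis_star r
    exact ⟨σ s, (star_basis_map_iff φ σ h r s).2 hs⟩
  const_real := by
    simp only [σ.surjective.forall, structConst_map φ σ h]
    exact hb.const_real
  degree_pos := by
    simp only [σ.surjective.forall, degree_map φ σ h]
    exact hb.degree_pos
  const_self := by
    simp only [σ.surjective.forall, structConst_map φ σ h, degree_map φ σ h,
      star_basis_map_iff φ σ h]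
    exact hb.const_self
  const_ne := by
    simp only [σ.surjective.forall, structConst_map φ σ h, ne_eq, star_basis_map_iff φ σ h]
    exact hb.const_ne
  degree_rep := by
    obtain ⟨χ, hχ⟩ := hb.degree_rep
    refine ⟨χ.comp (φ.symm : B →⋆ₐ[ℂ] A), ?_⟩
    simp only [σ.surjective.forall, degree_map φ σ h, h]
    intro r
    have : φ.symm (φ (b r)) = b r := φ.toAlgEquiv.symm_apply_apply (b r)
    simp [this, hχ]

theorem IsTableAlgebra.map [Fintype ι] [Fintype κ] [StarModule ℂ A] [StarModule ℂ B]
    (φ : A ≃⋆ₐ[ℂ] B) (σ : ι ≃ κ) (h : ∀ r, b' (σ r) = φ (b r)) {e : ι}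
    (hb : IsTableAlgebra b e) : IsTableAlgebra b' (σ e) := by
  refine ⟨hb.1.map φ σ h, ?_⟩
  simp only [σ.surjective.forall, structConst_map φ σ h]
  exact hb.2

theorem IsHomogeneous.map (φ : A ≃⋆ₐ[ℂ] B) (σ : ι ≃ κ) (h : ∀ r, b' (σ r) = φ (b r)) {e : ι}
    (hb : IsHomogeneous b e) : IsHomogeneous b' (σ e) := by
  simp only [IsHomogeneous, σ.surjective.forall, degree_map φ σ h, ne_eq, σ.injective.eq_iff]
  exact hb

theorem Isomorphic.of_map (φ : A ≃⋆ₐ[ℂ] B) (σ : ι ≃ κ) (h : ∀ r, b' (σ r) = φ (b r)) :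
    Isomorphic b b' := by
  refine ⟨φ, ?_⟩
  rw [← Set.range_comp, ← σ.surjective.range_comp b']
  exact congrArg Set.range (funext fun r => (h r).symm)

/-- The preimage of a partition under a bijection. -/
def pullbackPartition [Fintype ι] [DecidableEq ι] [Fintype κ] [DecidableEq κ] (σ : ι ≃ κ)
    (π : Finpartition (Finset.univ : Finset κ)) : Finpartition (Finset.univ : Finset ι) where
  parts := π.parts.map (Equiv.finsetCongr σ.symm).toEmbedding
  supIndep := by
    rw [Finset.supIndep_iff_pairwiseDisjoint]
    intro C hC D hD hne
    simp only [Finset.coe_map, Set.mem_image, Finset.mem_coe] at hC hD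
    obtain ⟨C, hC, rfl⟩ := hC
    obtain ⟨D, hD, rfl⟩ := hD
    have := π.disjoint hC hD (fun h => hne (by rw [h]))
    simpa [Function.onFun] using this
  sup_parts := by
    refine Finset.eq_univ_iff_forall.2 fun i => ?_
    obtain ⟨C, hC, hi⟩ := π.exists_mem (Finset.mem_univ (σ i))
    simp only [Finset.sup_map, Finset.mem_sup]
    exact ⟨C, hC, by simpa using hi⟩
  bot_notMem := by
    intro h
    obtain ⟨C, hC, h⟩ := Finset.mem_map.1 h
    refine π.ne_bot hC ?_
    simpa using h

theorem mem_pullbackPartition_parts [Fintype ι] [DecidableEq ι] [Fintype κ] [DecidableEq κ]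
    (σ : ι ≃ κ) (π : Finpartition (Finset.univ : Finset κ)) (C : Finset ι) :
    C ∈ (pullbackPartition σ π).parts ↔ Equiv.finsetCongr σ C ∈ π.parts := by
  have : (pullbackPartition σ π).parts = π.parts.map (Equiv.finsetCongr σ.symm).toEmbedding := rfl
  rw [this, Finset.mem_map_equiv, ← Equiv.finsetCongr_symm, Equiv.symm_symm]

/-- The fusion by `π` is realised on the image of the fusion by the pulled-back partition, so the
case of `C`-algebras applies to the restricted isomorphism. -/
theorem FusionIsCAlgebra.map [Fintype ι] [DecidableEq ι] [Fintype κ] [DecidableEq κ]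
    [StarModule ℂ A] [StarModule ℂ B]
    (φ : A ≃⋆ₐ[ℂ] B) (σ : ι ≃ κ) (h : ∀ r, b' (σ r) = φ (b r)) {e : ι}
    {π : Finpartition (Finset.univ : Finset κ)} (he : {σ e} ∈ π.parts)
    (he' : {e} ∈ (pullbackPartition σ π).parts)
    (hb : FusionIsCAlgebra b e (pullbackPartition σ π) he') : FusionIsCAlgebra b' (σ e) π he := by
  obtain ⟨S, c, hc, hS⟩ := hb
  let f : S →⋆ₐ[ℂ] B := (φ : A →⋆ₐ[ℂ] B).comp S.subtype
  have hf : Function.Injective f := φ.toAlgEquiv.injective.comp Subtype.val_injective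
  let ψ : S ≃⋆ₐ[ℂ] f.range := StarAlgEquiv.ofInjective f hf
  let τ : (pullbackPartition σ π).parts ≃ π.parts :=
    (Equiv.finsetCongr σ).subtypeEquiv (mem_pullbackPartition_parts σ π)
  let c' : Module.Basis π.parts ℂ f.range := (c.map ψ.toAlgEquiv.toLinearEquiv).reindex τ
  have hc' : ∀ C, c' (τ C) = ψ (c C) := fun C => by simp [c']
  refine ⟨f.range, c', ?_, ?_⟩
  · refine τ.surjective.forall.2 fun C => ?_
    have h1 : ((ψ (c C) : f.range) : B) = φ (c C : A) := rfl
    have h2 : ((τ C : π.parts) : Finset κ) = (C : Finset ι).map σ.toEmbedding := rfl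
    have h3 : φ (∑ r ∈ C.1, b r) = ∑ r ∈ C.1, φ (b r) := map_sum φ.toAlgEquiv _ _
    rw [hc', h1, hc, h2, h3, Finset.sum_map]
    exact Finset.sum_congr rfl fun r _ => (h r).symm
  · have h4 : τ ⟨{e}, he'⟩ = ⟨{σ e}, he⟩ := Subtype.ext (by simp [τ])
    rw [← h4]
    exact hS.map ψ τ hc'

theorem IsAmorphic.map [Fintype ι] [DecidableEq ι] [Fintype κ] [DecidableEq κ]
    [StarModule ℂ A] [StarModule ℂ B]
    (φ : A ≃⋆ₐ[ℂ] B) (σ : ι ≃ κ) (h : ∀ r, b' (σ r) = φ (b r)) {e : ι}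
    (hb : IsAmorphic b e) : IsAmorphic b' (σ e) := by
  refine ⟨hb.1.map φ σ h, fun π he => ?_⟩
  have he' : {e} ∈ (pullbackPartition σ π).parts := by
    rw [mem_pullbackPartition_parts]
    simpa using he
  exact (hb.2 _ he').map φ σ h he

theorem amorphicConst_map [Fintype ι] [DecidableEq ι] [Fintype κ] [DecidableEq κ] (σ : ι ≃ κ)
    (ε : ℤ) (e : ι) (d : κ → ℝ) (r s t : ι) :
    amorphicConst ε (σ e) d (σ r) (σ s) (σ t) = amorphicConst ε e (d ∘ σ) r s t := by
  have : ∑ i, d i = ∑ i, d (σ i) := (σ.sum_comp d).symm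
  simp only [amorphicConst, σ.injective.eq_iff, Function.comp_apply, this]

theorem InClass.map [Fintype ι] [DecidableEq ι] [Fintype κ] [DecidableEq κ]
    (φ : A ≃⋆ₐ[ℂ] B) (σ : ι ≃ κ) (h : ∀ r, b' (σ r) = φ (b r)) {e : ι} {ε : ℤ} {ν : ℕ} {d : ℝ}
    (hb : InClass b e ε ν d) : InClass b' (σ e) ε ν d where
  sign := hb.sign
  four_le := hb.four_le
  card_eq := (Fintype.card_congr σ).symm.trans hb.card_eq
  pos := hb.pos
  star_basis := by
    refine σ.surjective.forall.2 fun r => ?_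
    exact (star_basis_map_iff φ σ h r r).2 (hb.star_basis r)
  const_eq := by
    simp only [σ.surjective.forall, structConst_map φ σ h, amorphicConst_map, hb.const_eq]
    intro r s t
    congr 2
    funext i
    simp [σ.injective.eq_iff]

end Transport

/-! ### Symmetry of the structure constants and constancy forced by fusions. -/

section Structure

variable {ι A : Type*} [Fintype ι] [Ring A] [Algebra ℂ A] [StarRing A]
  [StarModule ℂ A] {b : Module.Basis ι ℂ A} {e : ι}

/-- Real structure constants and a fixed basis make every product of basis elements self-adjoint,
while the involution reverses products. -/
theorem IsCAlgebra.basis_mul_comm (h : IsCAlgebra b e) (hstar : ∀ r, star (b r) = b r)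
    (r s : ι) : b r * b s = b s * b r := by
  have h1 : star (b r * b s) = b r * b s := by
    conv_lhs => rw [← b.sum_repr (b r * b s)]
    conv_rhs => rw [← b.sum_repr (b r * b s)]
    rw [star_sum]
    refine Finset.sum_congr rfl fun t _ => ?_
    rw [star_smul, hstar]
    congr 1
    exact Complex.conj_eq_iff_im.2 (h.const_real r s t)
  rw [← h1, star_mul, hstar, hstar]

theorem IsCAlgebra.structConst_self_unit (h : IsCAlgebra b e) (hstar : ∀ r, star (b r) = b r)
    (r : ι) : structConst b r r e = degree b e r := h.const_self r r (hstar r)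

theorem IsCAlgebra.structConst_ne_unit (h : IsCAlgebra b e) (hstar : ∀ r, star (b r) = b r)
    {r s : ι} (hrs : r ≠ s) : structConst b r s e = 0 :=
  h.const_ne r s (by rw [hstar]; exact fun hb => hrs (b.injective hb))

theorem IsCAlgebra.repr_mul_basis_unit (h : IsCAlgebra b e) (hstar : ∀ r, star (b r) = b r)
    (a : A) (s : ι) : b.repr (a * b s) e = b.repr a s * degree b e s := by
  conv_lhs => rw [← b.sum_repr a]
  simp only [Finset.sum_mul, smul_mul_assoc, map_sum, map_smul, Finsupp.coe_finsetSum,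
    Finsupp.coe_smul, Finset.sum_apply, Pi.smul_apply, smul_eq_mul]
  rw [Finset.sum_eq_single s]
  · rw [← h.const_self s s (hstar s)]; rfl
  · intro r _ hr
    have := h.const_ne r s (by rw [hstar]; exact fun hb => hr (b.injective hb))
    rw [structConst] at this
    rw [this, mul_zero]
  · simp

/-- Both sides are the coefficient of the unit in the triple product of `b r`, `b s`, `b t`, by
associativity and commutativity. -/
theorem IsCAlgebra.structConst_rotate (h : IsCAlgebra b e) (hstar : ∀ r, star (b r) = b r)
    (r s t : ι) :
    structConst b r s t * degree b e t = structConst b s t r * degree b e r := by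
  rw [structConst, structConst, ← h.repr_mul_basis_unit hstar, ← h.repr_mul_basis_unit hstar,
    mul_assoc]
  conv_rhs => rw [← b.sum_repr (b s * b t)]
  conv_lhs => rw [← b.sum_repr (b s * b t)]
  simp only [Finset.sum_mul, Finset.mul_sum, smul_mul_assoc, mul_smul_comm,
    h.basis_mul_comm hstar r]

theorem IsCAlgebra.sum_structConst (h : IsCAlgebra b e) (r s : ι) :
    ∑ t, structConst b r s t * degree b e t = (degree b e r : ℂ) * degree b e s := by
  obtain ⟨χ, hχ⟩ := h.degree_rep
  rw [← hχ, ← hχ, ← map_mul]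
  conv_rhs => rw [← b.sum_repr (b r * b s)]
  simp only [map_sum, map_smul, hχ, smul_eq_mul, structConst]

theorem IsCAlgebra.degree_unit (h : IsCAlgebra b e) : degree b e e = 1 := by
  simp [degree, h.basis_one, show b.repr 1 e = 1 by simp [← h.basis_one]]

variable [DecidableEq ι]

/-- The fusions of an amorphic `C`-algebra are closed under multiplication and involution: the
elements whose coefficients are constant on the fibres of `f` form a `*`-subalgebra. -/
theorem IsAmorphic.exists_starSubalgebra (h : IsAmorphic b e) {κ : Type*} (f : ι → κ)
    (hf : ∀ i, f i = f e → i = e) :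
    ∃ B : StarSubalgebra ℂ A, ∀ a, a ∈ B ↔ ∀ i j, f i = f j → b.repr a i = b.repr a j := by
  classical
  let π := Finpartition.ofSetoid (Setoid.ker f)
  have hπ : ∀ i j, j ∈ π.part i ↔ f i = f j := fun i j => Finpartition.mem_part_ofSetoid_iff_rel
  have hcl : ∀ C ∈ π.parts, ∀ i ∈ C, ∀ j, j ∈ C ↔ f i = f j := by
    intro C hC i hi j
    rw [← hπ, π.part_eq_of_mem hC hi]
  have he : {e} ∈ π.parts := by
    have : π.part e = {e} := by
      ext j
      rw [hπ, Finset.mem_singleton]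
      exact ⟨fun hj => hf j hj.symm, fun hj => by rw [hj]⟩
    rw [← this]
    exact π.part_mem.2 (Finset.mem_univ e)
  obtain ⟨B, b', hb', -⟩ := h.2 π he
  refine ⟨B, fun a => ⟨fun ha i j hij => ?_, fun ha => ?_⟩⟩
  · have hsum : a = ∑ C : π.parts, b'.repr ⟨a, ha⟩ C • ∑ r ∈ C.1, b r := by
      have := congrArg Subtype.val (b'.sum_repr ⟨a, ha⟩)
      refine this.symm.trans ((AddSubmonoidClass.coe_finsetSum _ _).trans ?_)
      exact Finset.sum_congr rfl fun C _ => by rw [← hb']; rfl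
    rw [hsum]
    simp only [map_sum, map_smul, Finsupp.coe_finsetSum, Finsupp.coe_smul, Finset.sum_apply,
      Pi.smul_apply, Module.Basis.repr_self, Finsupp.single_apply, Finset.sum_ite_eq']
    refine Finset.sum_congr rfl fun C _ => ?_
    have : i ∈ C.1 ↔ j ∈ C.1 :=
      ⟨fun hi => (hcl C.1 C.2 i hi j).2 hij, fun hj => (hcl C.1 C.2 j hj i).2 hij.symm⟩
    simp [this]
  · have hsum : a = ∑ C ∈ π.parts, ∑ r ∈ C, b.repr a r • b r := by
      conv_lhs => rw [← b.sum_repr a]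
      exact (Finset.sum_congr π.biUnion_parts.symm fun _ _ => rfl).trans
        (Finset.sum_biUnion π.disjoint)
    rw [hsum]
    refine sum_mem fun C hC => ?_
    obtain ⟨i, hi⟩ := π.nonempty_of_mem_parts hC
    have : ∑ r ∈ C, b.repr a r • b r = b.repr a i • ((b' ⟨C, hC⟩ : B) : A) := by
      rw [hb', Finset.smul_sum]
      refine Finset.sum_congr rfl fun r hr => ?_
      rw [ha i r ((hcl C hC i hi r).1 hr)]
    rw [this]
    exact B.smul_mem (b' ⟨C, hC⟩).2 _

/-- The fusion that merges everything outside `e` and `r` contains `b r`, hence also its adjoint. -/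
theorem IsAmorphic.repr_star_eq (h : IsAmorphic b e) {r i j : ι} (hi : i ≠ e) (hir : i ≠ r)
    (hj : j ≠ e) (hjr : j ≠ r) : b.repr (star (b r)) i = b.repr (star (b r)) j := by
  obtain ⟨B, hB⟩ := h.exists_starSubalgebra (fun i => (decide (i = e), decide (i = r)))
    (by simp +contextual)
  refine (hB _).1 (star_mem ((hB (b r)).2 fun i j hij => ?_)) i j (by simp [*])
  simp only [Prod.mk.injEq, decide_eq_decide] at hij
  simp [Finsupp.single_apply, eq_comm (a := r), hij.2]

/-- The fusion that merges everything outside `e`, `r`, `s` contains both factors, hence their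
product. -/
theorem IsAmorphic.structConst_eq (h : IsAmorphic b e) {r s i j : ι} (hi : i ≠ e) (hir : i ≠ r)
    (his : i ≠ s) (hj : j ≠ e) (hjr : j ≠ r) (hjs : j ≠ s) :
    structConst b r s i = structConst b r s j := by
  obtain ⟨B, hB⟩ := h.exists_starSubalgebra
    (fun i => (decide (i = e), decide (i = r), decide (i = s))) (by simp +contextual)
  refine (hB _).1 (mul_mem ((hB (b r)).2 fun i j hij => ?_) ((hB (b s)).2 fun i j hij => ?_))
    i j (by simp [*])
  all_goals
    simp only [Prod.mk.injEq, decide_eq_decide] at hij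
    simp [Finsupp.single_apply, eq_comm (a := r), eq_comm (a := s), hij]

/-- If the adjoint of `b r` were another basis element `b s`, its coefficients would be `1` at `s`
and `0` at any further index, against `repr_star_eq`. So no further index exists and the rank is
`3`. -/
theorem IsAmorphic.star_basis (h : IsAmorphic b e) (hdim : Fintype.card ι ≠ 3) (r : ι) :
    star (b r) = b r := by
  obtain ⟨s, hs⟩ := h.1.basis_star r
  by_cases hr : r = e
  · rw [hr, h.1.basis_one, star_one]
  by_cases hse : s = e
  · rw [hse, h.1.basis_one, star_eq_iff_star_eq, star_one, ← h.1.basis_one] at hs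
    exact absurd (b.injective hs).symm hr
  by_cases hsr : s = r
  · rw [hs, hsr]
  refine absurd ?_ hdim
  have huniv : (Finset.univ : Finset ι) = {e, r, s} := by
    refine (Finset.eq_univ_iff_forall.2 fun i => ?_).symm
    by_contra hi
    simp only [Finset.mem_insert, Finset.mem_singleton, not_or] at hi
    have := h.repr_star_eq (r := r) hi.1 hi.2.1 hse hsr
    simp [hs, Ne.symm hi.2.2] at this
  rw [← Finset.card_univ, huniv]
  exact Finset.card_eq_three.2 ⟨e, r, s, Ne.symm hr, Ne.symm hse, Ne.symm hsr, rfl⟩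

end Structure

/-! ### Reduction of the multiplication table to one parameter. -/

section Parameter

/-- The sum of a function that is constant off `T`. -/
theorem sum_eq_of_eq_off {ι : Type*} [Fintype ι] (T : Finset ι) (F : ι → ℂ) (K : ℂ)
    (h : ∀ t, t ∉ T → F t = K) :
    ∑ t, F t = ∑ t ∈ T, F t + (Fintype.card ι - T.card) * K := by
  have h1 : ∑ t ∈ T, (F t - K) = ∑ t, (F t - K) :=
    Finset.sum_subset (Finset.subset_univ T) fun t _ ht => by rw [h t ht, sub_self]
  simp only [Finset.sum_sub_distrib, Finset.sum_const, nsmul_eq_mul, Finset.card_univ] at h1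
  linear_combination -h1

theorem repr_sum_basis {ι A : Type*} [Ring A] [Algebra ℂ A] [Fintype ι]
    (b : Module.Basis ι ℂ A) (t : ι) : b.repr (∑ s, b s) t = 1 := by
  simp

variable {ι A : Type*} [Fintype ι] [Ring A] [Algebra ℂ A] [StarRing A]

/-- The multiplication table of a homogeneous amorphic `C`-algebra of rank different from `3`, in
terms of the eigenvalue `y` that each basis element takes on all but two irreducible characters. -/
structure HasParameter (b : Module.Basis ι ℂ A) (e : ι) (y : ℝ) : Prop where
  basis_one : b e = 1
  star_basis : ∀ r, star (b r) = b r
  ne_zero : 1 + ((Fintype.card ι : ℝ) - 1) * y ≠ 0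
  totalDegree_eq : totalDegree b e = (1 + ((Fintype.card ι : ℝ) - 1) * y) ^ 2
  mul_self : ∀ r, r ≠ e → b r * b r =
    (y + (Fintype.card ι - 2) * y ^ 2 : ℂ) • 1 + (2 * y - 1 - (Fintype.card ι - 1) * y : ℂ) • b r +
      (y + y ^ 2 : ℂ) • ∑ t, b t
  mul_ne : ∀ r s, r ≠ e → s ≠ e → r ≠ s →
    b r * b s = (y : ℂ) • (b r + b s) + (y ^ 2 : ℂ) • (∑ t, b t - 1)

variable [StarModule ℂ A] {b : Module.Basis ι ℂ A} {e : ι}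

theorem IsCAlgebra.repr_one [DecidableEq ι] (h : IsCAlgebra b e) (t : ι) :
    b.repr 1 t = if t = e then 1 else 0 := by
  rw [← h.basis_one, Module.Basis.repr_self, Finsupp.single_apply]
  simp only [eq_comm]

theorem IsCAlgebra.sum_mul_basis (h : IsCAlgebra b e) (hstar : ∀ r, star (b r) = b r) (r : ι) :
    (∑ s, b s) * b r = (degree b e r : ℂ) • ∑ s, b s := by
  refine b.ext_elem fun t => ?_
  have hd : (degree b e t : ℂ) ≠ 0 := by exact_mod_cast (h.degree_pos t).ne'
  refine mul_right_cancel₀ hd ?_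
  have h1 : b.repr ((∑ s, b s) * b r) t = ∑ s, structConst b s r t := by
    simp [Finset.sum_mul, structConst]
  rw [h1, Finset.sum_mul]
  simp only [h.structConst_rotate hstar _ r t, h.sum_structConst, map_smul, Finsupp.smul_apply,
    repr_sum_basis, smul_eq_mul, mul_one]

theorem IsCAlgebra.totalDegree_eq (h : IsCAlgebra b e) {D : ℝ}
    (hD : ∀ r, r ≠ e → degree b e r = D) :
    totalDegree b e = 1 + ((Fintype.card ι : ℝ) - 1) * D := by
  have h1 := sum_eq_of_eq_off {e} (fun t => (degree b e t : ℂ)) D fun t ht => by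
    rw [hD t (by simpa using ht)]
  simp only [Finset.sum_singleton, Finset.card_singleton, h.degree_unit] at h1
  rw [totalDegree]
  exact_mod_cast h1

theorem IsCAlgebra.hasParameter_of_card_eq_one (h : IsCAlgebra b e)
    (hstar : ∀ r, star (b r) = b r) (hcard : Fintype.card ι = 1) : HasParameter b e 0 := by
  have hall : ∀ r, r = e := fun r => (Fintype.card_le_one_iff.1 hcard.le) r e
  refine ⟨h.basis_one, hstar, by simp, ?_, fun r hr => absurd (hall r) hr,
    fun r s hr => absurd (hall r) hr⟩
  rw [h.totalDegree_eq (D := 0) fun r hr => absurd (hall r) hr]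
  simp

variable [DecidableEq ι]

theorem IsCAlgebra.hasParameter_of_card_eq_two (h : IsCAlgebra b e)
    (hstar : ∀ r, star (b r) = b r) {D : ℝ} (hpos : 0 < D) (hD : ∀ r, r ≠ e → degree b e r = D)
    -- In rank `2` the table involves `y` only through `D = y² + 2y`; either root would serve.
    (hcard : Fintype.card ι = 2) : HasParameter b e (√(1 + D) - 1) := by
  have huniv : ∀ r, r ≠ e → (Finset.univ : Finset ι) = {e, r} := fun r hr =>
    (Finset.eq_univ_of_card _ (by rw [hcard, Finset.card_pair (Ne.symm hr)])).symm
  have hsq : √(1 + D) ^ 2 = 1 + D := Real.sq_sqrt (by positivity)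
  have hw : 0 < √(1 + D) := Real.sqrt_pos.2 (by positivity)
  refine ⟨h.basis_one, hstar, ?_, ?_, fun r hr => ?_, fun r s hr hs hrs => ?_⟩
  · rw [hcard]; push_cast; ring_nf; exact hw.ne'
  · rw [h.totalDegree_eq hD, hcard]; push_cast; linear_combination -hsq
  · have h1 := h.sum_structConst r r
    rw [huniv r hr, Finset.sum_pair (Ne.symm hr), h.structConst_self_unit hstar, h.degree_unit,
      hD r hr] at h1
    have hD0 : (D : ℂ) ≠ 0 := by exact_mod_cast hpos.ne'
    have h2 : structConst b r r r = D - 1 := by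
      refine mul_right_cancel₀ hD0 ?_
      push_cast at h1
      linear_combination h1
    have hsq' : ((√(1 + D) : ℝ) : ℂ) ^ 2 = 1 + D := by exact_mod_cast hsq
    refine b.ext_elem fun t => ?_
    have ht : t ∈ ({e, r} : Finset ι) := huniv r hr ▸ Finset.mem_univ t
    simp only [map_add, map_smul, Finsupp.add_apply, Finsupp.smul_apply, repr_sum_basis,
      h.repr_one, Module.Basis.repr_self, smul_eq_mul, hcard]
    rcases Finset.mem_insert.1 ht with rfl | ht
    · have h3 := h.structConst_self_unit hstar r
      rw [structConst, hD r hr] at h3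
      rw [h3, Finsupp.single_eq_of_ne (Ne.symm hr)]
      push_cast
      simp only [if_true]
      linear_combination -hsq'
    · rw [Finset.mem_singleton] at ht
      subst ht
      rw [structConst] at h2
      rw [h2, Finsupp.single_eq_same, if_neg hr]
      push_cast
      linear_combination -hsq'
  · have hs' : s ∈ ({e, r} : Finset ι) := huniv r hr ▸ Finset.mem_univ s
    simp only [Finset.mem_insert, Finset.mem_singleton, hs, false_or] at hs'
    exact absurd hs'.symm hrs

theorem IsAmorphic.hasParameter_of_four_le (h : IsAmorphic b e)
    (hstar : ∀ r, star (b r) = b r) {D : ℝ} (hpos : 0 < D) (hD : ∀ r, r ≠ e → degree b e r = D)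
    (hcard : 4 ≤ Fintype.card ι) : ∃ y, HasParameter b e y := by
  have hC := h.1
  have hD0 : (D : ℂ) ≠ 0 := by exact_mod_cast hpos.ne'
  have hN : (Fintype.card ι : ℂ) - 3 ≠ 0 := by
    rw [sub_ne_zero]; exact_mod_cast (by omega : Fintype.card ι ≠ 3)
  have hex : ∀ r s, ∃ t, t ≠ e ∧ t ≠ r ∧ t ≠ s := by
    intro r s
    obtain ⟨t, ht⟩ : ∃ t, t ∉ ({e, r, s} : Finset ι) := by
      by_contra! hall
      have := Finset.card_le_three (a := e) (b := r) (c := s)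
      rw [Finset.eq_univ_of_forall hall, Finset.card_univ] at this
      omega
    exact ⟨t, by simpa using ht⟩
  have hcomm : ∀ r s t, structConst b r s t = structConst b s r t := fun r s t => by
    rw [structConst, hC.basis_mul_comm hstar, structConst]
  have hrot : ∀ r s t, r ≠ e → t ≠ e → structConst b r s t = structConst b s t r := by
    intro r s t hr ht
    have := hC.structConst_rotate hstar r s t
    rw [hD r hr, hD t ht] at this
    exact mul_right_cancel₀ hD0 this
  have hXex : ∀ r, ∃ x : ℂ, ∀ t, t ≠ e → t ≠ r → structConst b r r t = x := fun r => by
    obtain ⟨i, hi, hir, -⟩ := hex r r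
    exact ⟨structConst b r r i, fun t ht htr => h.structConst_eq ht htr htr hi hir hir⟩
  have hGex : ∀ r s, ∃ g : ℂ, ∀ t, t ≠ e → t ≠ r → t ≠ s → structConst b r s t = g := fun r s => by
    obtain ⟨i, hi, hir, his⟩ := hex r s
    exact ⟨structConst b r s i, fun t ht htr hts => h.structConst_eq ht htr hts hi hir his⟩
  choose X hX using hXex
  choose G hG using hGex
  have hleft : ∀ r s, r ≠ e → s ≠ e → r ≠ s → structConst b r s r = X r := fun r s hr hs hrs => by
    rw [hrot r s r hr hr, hrot s r r hs hr, hX r s hs hrs.symm]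
  have hright : ∀ r s, r ≠ e → s ≠ e → r ≠ s → structConst b r s s = X s := fun r s hr hs hrs => by
    rw [hrot r s s hr hs, hX s r hr hrs]
  have hsum : ∀ r s, r ≠ e → s ≠ e → r ≠ s → (D : ℂ) = X r + X s + (Fintype.card ι - 3) * G r s := by
    intro r s hr hs hrs
    have h1 := hC.sum_structConst r s
    rw [sum_eq_of_eq_off {e, r, s} _ (G r s * D), Finset.sum_insert (by simp [hr.symm, hs.symm]),
      Finset.sum_pair hrs, Finset.card_eq_three.2 ⟨e, r, s, hr.symm, hs.symm, hrs, rfl⟩,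
      hC.structConst_ne_unit hstar hrs, hleft r s hr hs hrs, hright r s hr hs hrs,
      hD r hr, hD s hs] at h1
    · refine mul_right_cancel₀ hD0 ?_
      push_cast at h1
      linear_combination -h1
    · intro t ht
      simp only [Finset.mem_insert, Finset.mem_singleton, not_or] at ht
      rw [hG r s t ht.1 ht.2.1 ht.2.2, hD t ht.1]
  -- For a third element `r`, rotation identifies `G r s` with `G r t`; comparing the degree
  -- identities `hsum` for the two pairs gives the claim.
  have hXX : ∀ s t, s ≠ e → t ≠ e → X s = X t := by
    intro s t hs ht
    by_cases hst : s = t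
    · rw [hst]
    obtain ⟨r, hr, hrs, hrt⟩ := hex s t
    have h1 : G r s = G r t := by
      rw [← hG r s t ht hrt.symm (Ne.symm hst), ← hG r t s hs hrs.symm hst,
        hrot r s t hr ht, hrot s t r hs hr, hcomm t r s]
    have h2 := hsum r s hr hs hrs
    have h3 := hsum r t hr ht hrt
    rw [h1] at h2
    linear_combination h3 - h2
  obtain ⟨r₀, hr₀, -, -⟩ := hex e e
  obtain ⟨s₀, hs₀, hsr₀, -⟩ := hex r₀ r₀
  obtain ⟨t₀, ht₀, htr₀, hts₀⟩ := hex r₀ s₀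
  set x := X r₀ with hx
  set g := G r₀ s₀ with hg
  have hDg : (D : ℂ) = 2 * x + (Fintype.card ι - 3) * g := by
    have := hsum r₀ s₀ hr₀ hs₀ hsr₀.symm
    rw [hXX s₀ r₀ hs₀ hr₀] at this
    linear_combination this
  have hXx : ∀ r, r ≠ e → X r = x := fun r hr => hXX r r₀ hr hr₀
  have hGg : ∀ r s, r ≠ e → s ≠ e → r ≠ s → G r s = g := by
    intro r s hr hs hrs
    have := hsum r s hr hs hrs
    rw [hXx r hr, hXx s hs] at this
    refine mul_left_cancel₀ hN ?_
    linear_combination hDg - this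
  have hself : ∀ r, r ≠ e → structConst b r r r = D - 1 - (Fintype.card ι - 2) * x := by
    intro r hr
    have h1 := hC.sum_structConst r r
    rw [sum_eq_of_eq_off {e, r} _ (x * D), Finset.sum_pair hr.symm, Finset.card_pair hr.symm,
      hC.structConst_self_unit hstar, hC.degree_unit, hD r hr] at h1
    · refine mul_right_cancel₀ hD0 ?_
      push_cast at h1
      linear_combination h1
    · intro t ht
      simp only [Finset.mem_insert, Finset.mem_singleton, not_or] at ht
      rw [hX r t ht.1 ht.2, hXx r hr, hD t ht.1]
  have hmulne : ∀ r s, r ≠ e → s ≠ e → r ≠ s →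
      b r * b s = (x - g) • (b r + b s) + g • (∑ t, b t - 1) := by
    intro r s hr hs hrs
    refine b.ext_elem fun t => ?_
    simp only [map_add, map_sub, map_smul, Finsupp.add_apply, Finsupp.sub_apply,
      Finsupp.smul_apply, repr_sum_basis, hC.repr_one, Module.Basis.repr_self, smul_eq_mul]
    change structConst b r s t = _
    by_cases hte : t = e
    · rw [hte, hC.structConst_ne_unit hstar hrs]
      simp [hr, hs]
    by_cases htr : t = r
    · rw [htr, hleft r s hr hs hrs, hXx r hr]
      simp [hr, hrs.symm]
    by_cases hts : t = s
    · rw [hts, hright r s hr hs hrs, hXx s hs]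
      simp [hs, hrs]
    rw [hG r s t hte htr hts, hGg r s hr hs hrs]
    simp [hte, Ne.symm htr, Ne.symm hts]
  have hmulself : ∀ r, r ≠ e → b r * b r =
      (D - x) • 1 + (D - 1 - (Fintype.card ι - 1) * x) • b r + x • ∑ t, b t := by
    intro r hr
    refine b.ext_elem fun t => ?_
    simp only [map_add, map_smul, Finsupp.add_apply, Finsupp.smul_apply, repr_sum_basis,
      hC.repr_one, Module.Basis.repr_self, smul_eq_mul]
    change structConst b r r t = _
    by_cases hte : t = e
    · rw [hte, hC.structConst_self_unit hstar, hD r hr]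
      simp [hr]
    by_cases htr : t = r
    · rw [htr, hself r hr]
      simp [hr]
      ring
    rw [hX r t hte htr, hXx r hr]
    simp [hte, Ne.symm htr]
  -- Associativity of `b r₀ * b r₀ * b s₀` gives this last relation. At `t₀` only the multiples of
  -- `∑ t, b t` contribute, so subtracting that coefficient from the one at `r₀` removes them.
  have hgsq : g = (x - g) ^ 2 := by
    have hJ : ∀ r, r ≠ e → b r * ∑ t, b t = (D : ℂ) • ∑ t, b t := by
      intro r hr
      rw [← hD r hr, ← hC.sum_mul_basis hstar r, Finset.mul_sum, Finset.sum_mul]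
      exact Finset.sum_congr rfl fun s _ => hC.basis_mul_comm hstar r s
    have hJ' : (∑ t, b t) * b s₀ = (D : ℂ) • ∑ t, b t := by
      rw [← hD s₀ hs₀, hC.sum_mul_basis hstar]
    have hass := mul_assoc (b r₀) (b r₀) (b s₀)
    rw [hmulne r₀ s₀ hr₀ hs₀ hsr₀.symm, hmulself r₀ hr₀] at hass
    simp only [add_mul, smul_mul_assoc, mul_add, mul_sub, mul_smul_comm, one_mul, mul_one, hJ',
      hJ r₀ hr₀, hmulne r₀ s₀ hr₀ hs₀ hsr₀.symm, hmulself r₀ hr₀] at hass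
    have h1 := congrArg (fun a => b.repr a r₀) hass
    have h2 := congrArg (fun a => b.repr a t₀) hass
    simp only [map_add, map_sub, map_smul, Finsupp.add_apply, Finsupp.sub_apply,
      Finsupp.smul_apply, repr_sum_basis, hC.repr_one, Module.Basis.repr_self, smul_eq_mul,
      Finsupp.single_apply, hr₀, ht₀, hsr₀, htr₀.symm, hts₀.symm, if_true, if_false] at h1 h2
    linear_combination h1 - h2
  obtain ⟨y, hy⟩ : ∃ y : ℝ, (y : ℂ) = x - g := by
    have hxr : x.im = 0 := by
      rw [hx, ← hX r₀ s₀ hs₀ hsr₀]; exact hC.const_real _ _ _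
    have hgr : g.im = 0 := by
      rw [hg, ← hG r₀ s₀ t₀ ht₀ htr₀ hts₀]; exact hC.const_real _ _ _
    exact ⟨(x - g).re, Complex.ext (by simp) (by simp [hxr, hgr])⟩
  rw [← hy] at hgsq hmulne
  have hxy : x = y + y ^ 2 := by linear_combination hgsq - hy
  have hDy : (D : ℂ) = 2 * y + (Fintype.card ι - 1) * y ^ 2 := by
    rw [hDg, hxy, hgsq]; ring
  have hDy' : D = 2 * y + ((Fintype.card ι : ℝ) - 1) * y ^ 2 := by exact_mod_cast hDy
  have htot : totalDegree b e = (1 + ((Fintype.card ι : ℝ) - 1) * y) ^ 2 := by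
    rw [hC.totalDegree_eq hD, hDy']; ring
  refine ⟨y, hC.basis_one, hstar, fun h0 => ?_, htot, fun r hr => ?_, fun r s hr hs hrs => ?_⟩
  · rw [h0] at htot
    have : 0 < totalDegree b e :=
      Finset.sum_pos (fun r _ => hC.degree_pos r) ⟨e, Finset.mem_univ e⟩
    rw [htot] at this
    simp at this
  · rw [hmulself r hr, hDy, hxy]
    congr 3 <;> ring
  · rw [hmulne r s hr hs hrs, ← hgsq]

theorem IsAmorphic.exists_hasParameter (h : IsAmorphic b e) (hhom : IsHomogeneous b e)
    (hdim : Fintype.card ι ≠ 3) : ∃ y, HasParameter b e y := by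
  have hstar := h.star_basis hdim
  by_cases h1 : Fintype.card ι = 1
  · exact ⟨0, h.1.hasParameter_of_card_eq_one hstar h1⟩
  have hpos : 0 < Fintype.card ι := Fintype.card_pos_iff.2 ⟨e⟩
  obtain ⟨r, hr⟩ := Fintype.exists_ne_of_one_lt_card (by omega) e
  have hD : ∀ s, s ≠ e → degree b e s = degree b e r := fun s hs => hhom s r hs hr
  by_cases h2 : Fintype.card ι = 2
  · exact ⟨_, h.1.hasParameter_of_card_eq_two hstar (h.1.degree_pos r) hD h2⟩
  exact h.hasParameter_of_four_le hstar (h.1.degree_pos r) hD (by omega)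

end Parameter

/-! ### Primitive idempotents of a power of a field. -/

section PrimitiveIdempotents

theorem IsPrimitiveIdempotent.map {A B : Type*} [Ring A] [Ring B] (φ : A ≃+* B) {p : A}
    (hp : IsPrimitiveIdempotent p) : IsPrimitiveIdempotent (φ p) := by
  refine ⟨hp.1.map φ, fun h => hp.2.1 (φ.map_eq_zero_iff.1 h), fun x y hx hy hxy hyx h => ?_⟩
  have := hp.2.2 (φ.symm x) (φ.symm y) (hx.map φ.symm) (hy.map φ.symm)
    (by rw [← map_mul, hxy, map_zero]) (by rw [← map_mul, hyx, map_zero])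
    (by rw [← map_add, ← h, φ.symm_apply_apply])
  simpa using this

/-- Idempotents take only the values `0` and `1`, so a nonzero one splits off a coordinate
idempotent. Conversely, orthogonal summands of a coordinate idempotent vanish off that coordinate,
and one of them vanishes there too. -/
theorem isPrimitiveIdempotent_pi_iff {ι K : Type*} [DecidableEq ι] [Field K] (p : ι → K) :
    IsPrimitiveIdempotent p ↔ ∃ i, p = Pi.single i 1 := by
  have hval : ∀ x : ι → K, IsIdempotentElem x → ∀ i, x i = 0 ∨ x i = 1 := fun x hx i =>
    IsIdempotentElem.iff_eq_zero_or_one.1 (congrFun hx i)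
  have hsingle : ∀ i, IsIdempotentElem (Pi.single i 1 : ι → K) := fun i => by
    rw [IsIdempotentElem, ← Pi.single_mul, mul_one]
  constructor
  · rintro ⟨hidem, hne, hprim⟩
    obtain ⟨i, hi⟩ := Function.ne_iff.1 hne
    have hi1 : p i = 1 := (hval p hidem i).resolve_left hi
    have hmul : Pi.single i 1 * p = Pi.single i 1 := by
      funext j
      by_cases hj : j = i
      · subst hj; simp [hi1]
      · simp [hj]
    have hmul' : p * Pi.single i 1 = Pi.single i 1 := by rw [mul_comm, hmul]
    refine ⟨i, ?_⟩
    have hsub : IsIdempotentElem (p - Pi.single i 1) := by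
      rw [IsIdempotentElem, mul_sub, sub_mul, sub_mul, hidem, hmul, hmul', hsingle i, sub_self,
        sub_zero]
    have h1 : Pi.single i 1 * (p - Pi.single i 1) = 0 := by
      rw [mul_sub, hmul, hsingle i, sub_self]
    have h2 : (p - Pi.single i 1) * Pi.single i 1 = 0 := by
      rw [sub_mul, hmul', hsingle i, sub_self]
    rcases hprim _ _ (hsingle i) hsub h1 h2 (by simp) with h | h
    · have := congrFun h i
      simp at this
    · exact sub_eq_zero.1 h
  · rintro ⟨i, rfl⟩
    refine ⟨hsingle i, by simp, fun x y hx hy hxy _ h => ?_⟩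
    have hoff : ∀ j, j ≠ i → x j = 0 ∧ y j = 0 := by
      intro j hj
      have h1 := congrFun h j
      have h2 := congrFun hxy j
      simp only [Pi.single_eq_of_ne hj, Pi.add_apply, Pi.mul_apply, Pi.zero_apply] at h1 h2
      rcases mul_eq_zero.1 h2 with h3 | h3
      · rw [h3, zero_add] at h1; exact ⟨h3, h1.symm⟩
      · rw [h3, add_zero] at h1; exact ⟨h1.symm, h3⟩
    refine (mul_eq_zero.1 (congrFun hxy i)).imp (fun h0 => ?_) (fun h0 => ?_) <;>
    · funext j
      by_cases hj : j = i
      · rw [hj]; exact h0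
      · simp [hoff j hj]

/-- The primitive idempotents of an algebra isomorphic to a power of `ℂ`. -/
theorem exists_equiv_primIdem {ι A : Type*} [DecidableEq ι] [Ring A] (φ : A ≃+* (ι → ℂ)) :
    ∃ σ : ι ≃ PrimIdem A, ∀ i, (σ i).1 = φ.symm (Pi.single i 1) := by
  let f : ι → PrimIdem A := fun i => ⟨φ.symm (Pi.single i 1),
    ((isPrimitiveIdempotent_pi_iff _).2 ⟨i, rfl⟩).map φ.symm⟩
  refine ⟨Equiv.ofBijective f ⟨fun i j hij => ?_, fun p => ?_⟩, fun i => rfl⟩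
  · have h1 : (Pi.single i 1 : ι → ℂ) = Pi.single j 1 :=
      φ.symm.injective (congrArg Subtype.val hij)
    by_contra hne
    have := congrFun h1 i
    simp [hne] at this
  · obtain ⟨i, hi⟩ := (isPrimitiveIdempotent_pi_iff _).1 (p.2.map φ)
    exact ⟨i, Subtype.ext (by simp only [f]; rw [← hi, φ.symm_apply_apply])⟩

end PrimitiveIdempotents

/-! ### The character table and its self-duality. -/

section Duality

/-- The value of the basis element `r` at the irreducible character `i` of an algebra with
parameter `y`. -/
noncomputable def eigenmatrix {ι : Type*} [Fintype ι] [DecidableEq ι] (e : ι) (y : ℝ)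
    (i r : ι) : ℂ :=
  if r = e then 1
  else if i = e then 2 * y + (Fintype.card ι - 1) * y ^ 2
  else if i = r then y - (1 + (Fintype.card ι - 1) * y)
  else y

variable {ι A : Type*} [Fintype ι] [DecidableEq ι] [Ring A] [Algebra ℂ A] [StarRing A]
  {b : Module.Basis ι ℂ A} {e : ι} {y : ℝ}

theorem star_eigenmatrix (e : ι) (y : ℝ) (i r : ι) :
    star (eigenmatrix e y i r) = eigenmatrix e y i r := by
  unfold eigenmatrix
  split_ifs <;> simp

theorem sum_eigenmatrix (e : ι) (y : ℝ) (i : ι) :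
    ∑ r, eigenmatrix e y i r = if i = e then (1 + (Fintype.card ι - 1) * y : ℂ) ^ 2 else 0 := by
  by_cases hi : i = e
  · rw [sum_eq_of_eq_off {e} _ (2 * y + (Fintype.card ι - 1) * y ^ 2)]
    · simp [eigenmatrix, hi]
      ring
    · intro t ht
      simp [eigenmatrix, hi, Finset.mem_singleton.not.1 ht]
  · rw [sum_eq_of_eq_off {e, i} _ y, Finset.sum_pair (Ne.symm hi), Finset.card_pair (Ne.symm hi)]
    · simp [eigenmatrix, hi]
      ring
    · intro t ht
      simp only [Finset.mem_insert, Finset.mem_singleton, not_or] at ht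
      simp [eigenmatrix, hi, ht.1, Ne.symm ht.2]

/-- This is `P² = n I`, the source of self-duality: up to the factor `n`, the matrix is its own
inverse, so the first and second eigenmatrices coincide. -/
theorem sum_eigenmatrix_mul (e : ι) (y : ℝ) (i j : ι) :
    ∑ r, eigenmatrix e y j r * eigenmatrix e y r i =
      if i = j then (1 + (Fintype.card ι - 1) * y : ℂ) ^ 2 else 0 := by
  by_cases hi : i = e
  · have : ∀ r, eigenmatrix e y r i = 1 := fun r => by simp [eigenmatrix, hi]
    simp only [this, mul_one, sum_eigenmatrix]
    simp only [hi, eq_comm]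
  by_cases hji : j = i
  · subst hji
    rw [sum_eq_of_eq_off {e, j} _ (y ^ 2), Finset.sum_pair (Ne.symm hi),
      Finset.card_pair (Ne.symm hi)]
    · simp [eigenmatrix, hi]
      ring
    · intro t ht
      simp only [Finset.mem_insert, Finset.mem_singleton, not_or] at ht
      simp [eigenmatrix, hi, ht.1, Ne.symm ht.2, ht.2]
      ring
  by_cases hj : j = e
  · subst hj
    rw [sum_eq_of_eq_off {j, i} _ ((2 * y + (Fintype.card ι - 1) * y ^ 2) * y),
      Finset.sum_pair hji, Finset.card_pair hji]
    · simp [eigenmatrix, hi]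
      ring
    · intro t ht
      simp only [Finset.mem_insert, Finset.mem_singleton, not_or] at ht
      simp [eigenmatrix, hi, ht.1, ht.2]
  · rw [sum_eq_of_eq_off {e, i, j} _ (y ^ 2),
      Finset.sum_insert (by simp [Ne.symm hi, Ne.symm hj]), Finset.sum_pair (Ne.symm hji),
      Finset.card_eq_three.2 ⟨e, i, j, Ne.symm hi, Ne.symm hj, Ne.symm hji, rfl⟩]
    · simp [eigenmatrix, hi, hj, hji, Ne.symm hji]
      ring
    · intro t ht
      simp only [Finset.mem_insert, Finset.mem_singleton, not_or] at ht
      simp [eigenmatrix, hi, hj, ht.1, ht.2.1, Ne.symm ht.2.2]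
      ring

/-- Each row of the matrix is a character. The check is short because the sum of the basis vanishes
at every row except `e`. -/
theorem HasParameter.eigenmatrix_mul (h : HasParameter b e y) (f : A →ₗ[ℂ] (ι → ℂ))
    (hf : ∀ r i, f (b r) i = eigenmatrix e y i r) (r s : ι) :
    f (b r * b s) = f (b r) * f (b s) := by
  have hone : f 1 = 1 := by
    funext i
    rw [← h.basis_one, hf]
    simp [eigenmatrix]
  have hJ : ∀ i, f (∑ t, b t) i =
      if i = e then (1 + (Fintype.card ι - 1) * y : ℂ) ^ 2 else 0 := fun i => by
    rw [map_sum, Finset.sum_apply]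
    simp only [hf, sum_eigenmatrix]
  by_cases hr : r = e
  · rw [hr, h.basis_one, hone, one_mul, one_mul]
  by_cases hs : s = e
  · rw [hs, h.basis_one, hone, mul_one, mul_one]
  funext i
  by_cases hrs : r = s
  · subst hrs
    rw [h.mul_self r hr]
    simp only [map_add, map_smul, Pi.add_apply, Pi.smul_apply, Pi.mul_apply, hone, Pi.one_apply,
      hJ, hf, smul_eq_mul, eigenmatrix, if_neg hr]
    split_ifs <;> ring
  · rw [h.mul_ne r s hr hs hrs]
    simp only [map_add, map_sub, map_smul, Pi.add_apply, Pi.sub_apply, Pi.smul_apply,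
      Pi.mul_apply, hone, Pi.one_apply, hJ, hf, smul_eq_mul, eigenmatrix, if_neg hr, if_neg hs]
    split_ifs with h1 h2 h3
    · ring
    · exact absurd (h2.symm.trans h3) hrs
    all_goals ring

/-- An algebra with parameter `y` is isomorphic to a power of `ℂ`, through its characters. -/
theorem HasParameter.exists_starAlgEquiv [StarModule ℂ A] (h : HasParameter b e y) :
    ∃ φ : A ≃⋆ₐ[ℂ] (ι → ℂ), (∀ r i, φ (b r) i = eigenmatrix e y i r) ∧
      ∀ i, φ ((totalDegree b e : ℂ)⁻¹ • ∑ r, eigenmatrix e y r i • b r) = Pi.single i 1 := by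
  let f : A →ₗ[ℂ] (ι → ℂ) := b.constr ℂ fun r i => eigenmatrix e y i r
  have hf : ∀ r i, f (b r) i = eigenmatrix e y i r := fun r i =>
    congrFun (b.constr_basis ℂ _ r) i
  have hn : (totalDegree b e : ℂ) = (1 + (Fintype.card ι - 1) * y : ℂ) ^ 2 := by
    exact_mod_cast h.totalDegree_eq
  have hw : (1 + (Fintype.card ι - 1) * y : ℂ) ≠ 0 := by exact_mod_cast h.ne_zero
  have hidem : ∀ i, f ((totalDegree b e : ℂ)⁻¹ • ∑ r, eigenmatrix e y r i • b r) =
      Pi.single i 1 := by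
    intro i
    funext j
    have := sum_eigenmatrix_mul e y i j
    simp only [map_smul, map_sum, Pi.smul_apply, Finset.sum_apply, hf, smul_eq_mul]
    simp only [mul_comm (eigenmatrix e y _ i), this, hn, Pi.single_apply, eq_comm (a := j)]
    split_ifs
    · exact inv_mul_cancel₀ (pow_ne_zero 2 hw)
    · exact mul_zero _
  -- The preimages of the coordinate idempotents in `hidem` span the target; injectivity then
  -- follows by dimension.
  have hsurj : Function.Surjective f := by
    intro g
    refine ⟨∑ i, g i • ((totalDegree b e : ℂ)⁻¹ • ∑ r, eigenmatrix e y r i • b r), ?_⟩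
    simp only [map_sum, map_smul f (g _), hidem]
    funext j
    simp [Pi.single_apply]
  have hfin : Module.finrank ℂ A = Module.finrank ℂ (ι → ℂ) := by
    rw [Module.finrank_eq_card_basis b, Module.finrank_fintype_fun_eq_card]
  have : FiniteDimensional ℂ A := Module.Basis.finiteDimensional_of_finite b
  have hinj : Function.Injective f :=
    (LinearMap.injective_iff_surjective_of_finrank_eq_finrank hfin).2 hsurj
  have hone : f 1 = 1 := by
    funext i
    rw [← h.basis_one, hf]
    simp [eigenmatrix]
  have hmul : ∀ x z, f (x * z) = f x * f z := by
    refine (LinearMap.map_mul_iff f).2 (b.ext fun r => b.ext fun s => ?_)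
    exact h.eigenmatrix_mul f hf r s
  have hstar : ∀ x, f (star x) = star (f x) := by
    intro x
    rw [← b.sum_repr x]
    simp only [star_sum, map_sum, star_smul, map_smul, h.star_basis]
    refine Finset.sum_congr rfl fun r _ => ?_
    funext i
    simp only [Pi.smul_apply, Pi.star_apply, hf, star_eigenmatrix]
  let φ : A ≃⋆ₐ[ℂ] (ι → ℂ) := StarAlgEquiv.ofAlgEquiv
    (AlgEquiv.ofBijective (AlgHom.ofLinearMap f hone hmul) ⟨hinj, hsurj⟩) hstar
  exact ⟨φ, hf, hidem⟩

end Duality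

end CAlg

theorem mainTheorem9 {ι A : Type*} [Fintype ι] [DecidableEq ι] [Ring A] [Algebra ℂ A]
    [StarRing A] [StarModule ℂ A] (b : Module.Basis ι ℂ A) (e : ι)
    (htable : CAlg.IsTableAlgebra b e) (hhom : CAlg.IsHomogeneous b e)
    (hamorphic : CAlg.IsAmorphic b e) (hdim : Fintype.card ι ≠ 3) :
    ∃ (_ : Fintype (CAlg.PrimIdem A)) (b' : Module.Basis (CAlg.PrimIdem A) ℂ (ι → ℂ))
      (e' : CAlg.PrimIdem A),
      (∀ p, b' p = CAlg.dualElem b e p) ∧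
      CAlg.IsTableAlgebra b' e' ∧ CAlg.IsHomogeneous b' e' ∧ CAlg.IsAmorphic b' e' ∧
      (∀ (ε : ℤ) (ν : ℕ) (d : ℝ), CAlg.InClass b e ε ν d → CAlg.InClass b' e' ε ν d) ∧
      CAlg.Isomorphic b b' := by
  obtain ⟨y, hy⟩ := hamorphic.exists_hasParameter hhom hdim
  obtain ⟨φ, hφ, hidem⟩ := hy.exists_starAlgEquiv
  obtain ⟨σ, hσ⟩ := CAlg.exists_equiv_primIdem (φ.toAlgEquiv : A ≃+* (ι → ℂ))
  let _ : Fintype (CAlg.PrimIdem A) := Fintype.ofEquiv ι σ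
  -- The transported basis, with `b r` relabelled by the idempotent of the character `r`. That it is
  -- the dual basis is the only point left after transport.
  let b' : Module.Basis (CAlg.PrimIdem A) ℂ (ι → ℂ) :=
    (b.map φ.toAlgEquiv.toLinearEquiv).reindex σ
  have hb' : ∀ r, b' (σ r) = φ (b r) := fun r => by simp [b']
  have hn : (CAlg.totalDegree b e : ℂ) ≠ 0 := by
    rw [hy.totalDegree_eq]
    exact_mod_cast pow_ne_zero 2 hy.ne_zero
  refine ⟨inferInstance, b', σ e, ?_, htable.map φ σ hb', hhom.map φ σ hb',
    hamorphic.map φ σ hb', fun ε ν d h => h.map φ σ hb', CAlg.Isomorphic.of_map φ σ hb'⟩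
  refine σ.surjective.forall.2 fun r => ?_
  -- Multiplied by `n`, these coefficients form column `r` of the character table, which lists the
  -- values of `φ (b r)`.
  have hp : (σ r).1 = (CAlg.totalDegree b e : ℂ)⁻¹ • ∑ s, CAlg.eigenmatrix e y s r • b s := by
    rw [hσ, ← hidem r]
    exact φ.toAlgEquiv.symm_apply_apply _
  funext i
  rw [hb', hφ, CAlg.dualElem, hp]
  simp [Finsupp.single_apply, mul_inv_cancel_left₀ hn]
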